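/- Let $a,d\in\mathbb N$ and let $\mathbf X_{ik}=(X_{ijk})_{j=1}^d$, $i=1,\dots,a$, $k=1,2,\dots$, be independent $\mathbb R^d$-valued random vectors such that, for each $i$, all $\mathbf X_{ik}$ have the same distribution. Let $F_{ij}(x)=\tfrac12\big(P(X_{ij1}<x)+P(X_{ij1}\le x)\big)$ be the normalized distribution function of the $j$-th component in group $i$, let $G_j=\frac1a\sum_{i=1}^aF_{ij}$, and let $\mathbf p=(p_{11},p_{12},\dots,p_{ad})'$ with $p_{ij}=\int G_j\,dF_{ij}$. For sample sizes $n_1,\dots,n_a$ put $N=\sum_{i=1}^an_i$ and $\widehat{\mathbf p}=(\widehat p_{11},\widehat p_{12},\dots,\widehat p_{ad})'$, where $$\widehat p_{ij}=\frac1a\sum_{\ell=1}^a\widehat w_{\ell ij},\qquad \widehat w_{\ell ij}=\frac1{n_\ell n_i}\sum_{k=1}^{n_i}\sum_{r=1}^{n_\ell}c(X_{ijk}-X_{\ell jr}),\qquad c(u)=\mathbf 1\{u>0\}+\tfrac12\mathbf 1\{u=0\}.$$ Assume that the sample sizes run through a sequence with $N\to\infty$ and $n_i/N\to\lambda_i\in(0,1)$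 for every $i=1,\dots,a$. Define the matrix $\boldsymbol\Sigma\in\mathbb R^{ad\times ad}$, with rows and columns indexed by the pairs $(i,j)$, by $\boldsymbol\Sigma_{(i,j),(i',j')}=\frac1{a^2}\sum_{\ell=1}^a\sum_{\ell'=1}^a\sigma_{\ell ij,\ell'i'j'}$, where $$\begin{aligned}\sigma_{\ell ij,\ell'i'j'}={}&\frac{\delta_{\ell\ell'}}{\lambda_\ell}\operatorname{cov}\big(F_{ij}(X_{\ell j1}),F_{i'j'}(X_{\ell j'1})\big)-\frac{\delta_{\ell i'}}{\lambda_\ell}\operatorname{cov}\big(F_{ij}(X_{\ell j1}),F_{\ell'j'}(X_{\ell j'1})\big)\\&+\frac{\delta_{ii'}}{\lambda_i}\operatorname{cov}\big(F_{\ell j}(X_{ij1}),F_{\ell'j'}(X_{ij'1})\big)-\frac{\delta_{i\ell'}}{\lambda_i}\operatorname{cov}\big(F_{\ell j}(X_{ij1}),F_{i'j'}(X_{ij'1})\big)\end{aligned}$$ and $\delta$ is Kronecker's delta. Let $\mathbf T\in\mathbb R^{ad\times ad}$ be symmetric and idempotent, and suppose that the null hypothesis $\mathbf T\mathbf p=\mathbf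 0$ holds. Then $\boldsymbol\Sigma$ is symmetric and positive semidefinite and, for $\mathbf Z\sim N_{ad}(\mathbf 0,\boldsymbol\Sigma)$, the ANOVA-type statistic satisfies $$T_N=N\,\widehat{\mathbf p}'\mathbf T\widehat{\mathbf p}\ \xrightarrow{\ d\ }\ \mathbf Z'\mathbf T\mathbf Z\ \overset{d}{=}\ \sum_{h=1}^{ad}\nu_hY_h^2,$$ where $Y_1,\dots,Y_{ad}$ are independent and standard normally distributed and $\nu_1,\dots,\nu_{ad}\ge0$ are the eigenvalues, counted with multiplicity, of $\boldsymbol\Sigma^{1/2}\mathbf T\boldsymbol\Sigma^{1/2}$. -/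

import Mathlib

open MeasureTheory ProbabilityTheory Filter Topology Matrix
open scoped MatrixOrder

namespace RankMANOVA

noncomputable section

/-- The normalized count function `c(u) = 1{u > 0} + (1/2) 1{u = 0}`. -/
def c (u : ℝ) : ℝ := if 0 < u then 1 else if u = 0 then 1 / 2 else 0

/-- The normalized distribution function of `μ`: the mean of the left-continuous and the
right-continuous version. -/
def normCDF (μ : Measure ℝ) (x : ℝ) : ℝ := (μ.real (Set.Iio x) + μ.real (Set.Iic x)) / 2

/-- The law of the `j`-th component in group `i`, where `Q i` is the law of an observation vector
of group `i`. -/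
def marginal {a d : ℕ} (Q : Fin a → Measure (Fin d → ℝ)) (i : Fin a) (j : Fin d) : Measure ℝ :=
  (Q i).map (fun x => x j)

/-- The normalized distribution function `F_{ij}`. -/
def F {a d : ℕ} (Q : Fin a → Measure (Fin d → ℝ)) (i : Fin a) (j : Fin d) (x : ℝ) : ℝ :=
  normCDF (marginal Q i j) x

/-- The unweighted mean distribution function `G_j`. -/
def G {a d : ℕ} (Q : Fin a → Measure (Fin d → ℝ)) (j : Fin d) (x : ℝ) : ℝ :=
  (1 / (a : ℝ)) * ∑ i : Fin a, F Q i j x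

/-- The vector of effects `p_{ij} = ∫ G_j dF_{ij}`. -/
def effect {a d : ℕ} (Q : Fin a → Measure (Fin d → ℝ)) : Fin a × Fin d → ℝ :=
  fun h => ∫ x, G Q h.2 x ∂(marginal Q h.1 h.2)

/-- The estimator of the Mann-Whitney effect of groups `l` and `i` in component `j`, based on the
first `n i` observation vectors `X i 0, …, X i (n i - 1)` of each group `i`. -/
def wHat {Ω : Type*} {a d : ℕ} (X : Fin a → ℕ → Ω → Fin d → ℝ) (n : Fin a → ℕ)
    (l i : Fin a) (j : Fin d) (ω : Ω) : ℝ :=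
  (1 / (n l : ℝ)) * (1 / (n i : ℝ)) *
    ∑ k ∈ Finset.range (n i), ∑ r ∈ Finset.range (n l), c (X i k ω j - X l r ω j)

/-- The vector of estimated effects. -/
def pHat {Ω : Type*} {a d : ℕ} (X : Fin a → ℕ → Ω → Fin d → ℝ) (n : Fin a → ℕ) (ω : Ω) :
    Fin a × Fin d → ℝ :=
  fun h => (1 / (a : ℝ)) * ∑ l : Fin a, wHat X n l h.1 h.2 ω

/-- The total sample size. -/
def total {a : ℕ} (n : Fin a → ℕ) : ℕ := ∑ i : Fin a, n i

/-- The ANOVA-type statistic `N p̂' T p̂`. -/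
def ATS {Ω : Type*} {a d : ℕ} (T : Matrix (Fin a × Fin d) (Fin a × Fin d) ℝ)
    (X : Fin a → ℕ → Ω → Fin d → ℝ) (n : Fin a → ℕ) (ω : Ω) : ℝ :=
  (total n : ℝ) * (pHat X n ω ⬝ᵥ (T *ᵥ pHat X n ω))

/-- `cov (F_{ij}(X_{lj1}), F_{i'j'}(X_{lj'1}))`. -/
def covF {a d : ℕ} (Q : Fin a → Measure (Fin d → ℝ)) (l i : Fin a) (j : Fin d) (i' : Fin a)
    (j' : Fin d) : ℝ :=
  covariance (fun x : Fin d → ℝ => F Q i j (x j)) (fun x : Fin d → ℝ => F Q i' j' (x j')) (Q l)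

/-- The asymptotic covariance of `√N ŵ_{lij}` and `√N ŵ_{l'i'j'}`, when `n_i / N → lam i`. -/
def sigmaW {a d : ℕ} (Q : Fin a → Measure (Fin d → ℝ)) (lam : Fin a → ℝ)
    (l i : Fin a) (j : Fin d) (l' i' : Fin a) (j' : Fin d) : ℝ :=
  (if l = l' then (1 / lam l) * covF Q l i j i' j' else 0)
    - (if l = i' then (1 / lam l) * covF Q l i j l' j' else 0)
    + (if i = i' then (1 / lam i) * covF Q i l j l' j' else 0)
    - (if i = l' then (1 / lam i) * covF Q i l j i' j' else 0)

/-- The asymptotic covariance matrix `Σ` of `√N (p̂ - p)`. -/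
def Sigma {a d : ℕ} (Q : Fin a → Measure (Fin d → ℝ)) (lam : Fin a → ℝ) :
    Matrix (Fin a × Fin d) (Fin a × Fin d) ℝ :=
  fun h h' => (1 / (a : ℝ) ^ 2) *
    ∑ l : Fin a, ∑ l' : Fin a, sigmaW Q lam l h.1 h.2 l' h'.1 h'.2

/-- The sample size condition: `N → ∞` and `n_i / N → lam i ∈ (0, 1)` for all groups `i`, along a
sequence `n 0, n 1, …` of vectors of sample sizes. -/
structure SampleSizeCondition {a : ℕ} (n : ℕ → Fin a → ℕ) (lam : Fin a → ℝ) : Prop where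
  total_tendsto : Tendsto (fun m => total (n m)) atTop atTop
  ratio_tendsto : ∀ i, Tendsto (fun m => (n m i : ℝ) / (total (n m) : ℝ)) atTop (𝓝 (lam i))
  lam_mem : ∀ i, lam i ∈ Set.Ioo (0 : ℝ) 1

/-- The model: all observation vectors are independent, and those of group `i` have law `Q i`. -/
structure FactorialModel {Ω : Type*} [MeasurableSpace Ω] (P : Measure Ω) {a d : ℕ}
    (X : Fin a → ℕ → Ω → Fin d → ℝ) (Q : Fin a → Measure (Fin d → ℝ)) : Prop where
  indep : iIndepFun (fun (ik : Fin a × ℕ) => X ik.1 ik.2) P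
  law : ∀ i k, HasLaw (X i k) (Q i) P

end

end RankMANOVA

/-! Each estimated Mann-Whitney effect is a two-sample U-statistic. Its Hoeffding decomposition
(`pHat_sub_effect`) writes the error of the estimated effects as a sum over groups of means of
centered i.i.d. vectors (`influence`), plus a completely degenerate remainder. By independence the
summands of the remainder are orthogonal, so its first absolute moment is of order `1 / √(n_i n_l)`
and it disappears after scaling by `√N` (`tendsto_integral_abs_pairRemainder`).

The linear part is treated by characteristic functions: for each direction `t`, independence yields
a product of powers, and a second-order Taylor expansion yields the Gaussian limit
(`tendsto_charFun_map_sum_groups`). The scaling `√N / n_g` gives group `g` the weight `1 / λ_g`, and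
`sum_covariance_influence` identifies the resulting covariance as `Sigma`; being a nonnegative
combination of covariance matrices, it is positive semidefinite.

Under the null hypothesis the statistic is a quadratic form in the centered scaled estimator
(`ATS_eq_quadraticForm`), so continuous mapping transfers the limit. With `Z = Σ^{1/2} x` for a
standard Gaussian `x`, the limiting form has matrix `Σ^{1/2} T Σ^{1/2}`, which is diagonalized in an
orthonormal eigenbasis (`identDistrib_quadraticForm`). -/

namespace RankMANOVA

/-! ### Central limit theorem for several independent groups, by characteristic functions -/

section CentralLimit

lemma tendsto_pow_exp_of_tendsto_mul_sub_one {ι : Type*} {l : Filter ι} {k : ι → ℕ} {f : ι → ℂ}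
    {t : ℂ} (hk : Tendsto k l atTop) (h : Tendsto (fun i => (k i : ℂ) * (f i - 1)) l (𝓝 t)) :
    Tendsto (fun i => f i ^ k i) l (𝓝 (Complex.exp t)) := by
  have hinv : Tendsto (fun i => ((k i : ℂ))⁻¹) l (𝓝 0) :=
    tendsto_inv_atTop_nhds_zero_nat (𝕜 := ℂ) |>.comp hk
  have hne : ∀ᶠ i in l, k i ≠ 0 := hk.eventually (eventually_ne_atTop 0)
  have hf0 : Tendsto (fun i => f i - 1) l (𝓝 0) := by
    have := hinv.mul h
    rw [zero_mul] at this
    refine this.congr' ?_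
    filter_upwards [hne] with i hi
    rw [inv_mul_cancel_left₀ (by exact_mod_cast hi)]
  have hf1 : Tendsto f l (𝓝 1) := by simpa using hf0.add_const 1
  -- The derivative of `log` at 1 is 1, so `log z - (z - 1) = o(z - 1)`; multiplying by `k` leaves
  -- an error `o(1)`, since `k (f - 1)` converges.
  have hlog := ((Complex.hasDerivAt_log (z := 1) (by simp)).isLittleO).comp_tendsto hf1
  have hlog' : (fun i => (k i : ℂ) * (Complex.log (f i) - (f i - 1))) =o[l]
      fun i => (k i : ℂ) * (f i - 1) := by
    refine (Asymptotics.isBigO_refl (fun i => (k i : ℂ)) l).mul_isLittleO ?_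
    simpa [Function.comp_def] using hlog
  have hzero : Tendsto (fun i => (k i : ℂ) * (Complex.log (f i) - (f i - 1))) l (𝓝 0) :=
    (Asymptotics.isLittleO_one_iff ℂ).1 (hlog'.trans_isBigO (h.isBigO_one ℂ))
  have hsum : Tendsto (fun i => (k i : ℂ) * Complex.log (f i)) l (𝓝 t) := by
    have := hzero.add h
    rw [zero_add] at this
    exact this.congr fun i => by ring
  refine ((Complex.continuous_exp.tendsto _).comp hsum).congr' ?_
  filter_upwards [hf1.eventually_ne one_ne_zero] with i hi
  simp [Complex.exp_nat_mul, Complex.exp_log hi]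

/-- Second-order Taylor expansion at 0, available because the second moment is finite; centering
removes the linear term. -/
lemma charFun_sub_isLittleO {μ : Measure ℝ} [IsProbabilityMeasure μ] (hμ : MemLp id 2 μ)
    (h0 : ∫ x, x ∂μ = 0) :
    (fun t : ℝ => charFun μ t - (1 - ((∫ x, x ^ 2 ∂μ : ℝ) : ℂ) * t ^ 2 / 2)) =o[𝓝 0]
      fun t : ℝ => (t : ℂ) ^ 2 := by
  have h := taylor_isLittleO_univ (x₀ := 0) (contDiff_charFun (n := 2) (μ := μ) (by simpa using hμ))
  have h2 (t : ℝ) := taylorWithinEval_charFun_two_zero (P := μ) (X := id) aemeasurable_id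
    (by simpa using hμ) t
  simp only [Measure.map_id] at h2
  simp_rw [h2] at h
  simp only [id, h0, Pi.pow_apply, sub_zero, Complex.ofReal_zero, zero_mul, add_zero] at h
  exact (h.norm_right.congr_right fun t => by simp).of_norm_right

/-- The arguments `u` tend to 0 because `k u²` converges while `k → ∞`; the Taylor expansion then
gives `k (φ(u) - 1) → -s σ² / 2`. -/
lemma tendsto_charFun_pow {ι : Type*} {l : Filter ι} {μ : Measure ℝ} [IsProbabilityMeasure μ]
    (hμ : MemLp id 2 μ) (h0 : ∫ x, x ∂μ = 0) {k : ι → ℕ} {u : ι → ℝ} {s : ℝ}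
    (hk : Tendsto k l atTop) (hu : Tendsto (fun i => (k i : ℝ) * u i ^ 2) l (𝓝 s)) :
    Tendsto (fun i => charFun μ (u i) ^ k i) l
      (𝓝 (Complex.exp (-((s * ∫ x, x ^ 2 ∂μ : ℝ) / 2 : ℂ)))) := by
  refine tendsto_pow_exp_of_tendsto_mul_sub_one hk ?_
  have hinv : Tendsto (fun i => ((k i : ℝ))⁻¹) l (𝓝 0) :=
    tendsto_inv_atTop_zero.comp (tendsto_natCast_atTop_atTop.comp hk)
  have hsq : Tendsto (fun i => u i ^ 2) l (𝓝 0) := by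
    have := hinv.mul hu
    rw [zero_mul] at this
    refine this.congr' ?_
    filter_upwards [hk.eventually (eventually_ne_atTop 0)] with i hi
    rw [inv_mul_cancel_left₀ (by exact_mod_cast hi)]
  have hu0 : Tendsto u l (𝓝 0) := by
    refine (tendsto_zero_iff_abs_tendsto_zero _).2 ?_
    have := (Real.continuous_sqrt.tendsto 0).comp hsq
    simpa [Function.comp_def, Real.sqrt_sq_eq_abs] using this
  have hO := (charFun_sub_isLittleO hμ h0).comp_tendsto hu0
  have hO' : (fun i => (k i : ℂ) * (charFun μ (u i) -
      (1 - ((∫ x, x ^ 2 ∂μ : ℝ) : ℂ) * (u i) ^ 2 / 2))) =o[l]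
      fun i => (k i : ℂ) * (u i : ℂ) ^ 2 :=
    (Asymptotics.isBigO_refl (fun i => (k i : ℂ)) l).mul_isLittleO hO
  have hc : Tendsto (fun i => (k i : ℂ) * (u i : ℂ) ^ 2) l (𝓝 (s : ℂ)) :=
    by
    simpa [Function.comp_def] using (Complex.continuous_ofReal.tendsto s).comp hu
  have hz := (Asymptotics.isLittleO_one_iff ℂ).1 (hO'.trans_isBigO (hc.isBigO_one ℂ))
  have := hz.sub (hc.mul_const (((∫ x, x ^ 2 ∂μ : ℝ) : ℂ) / 2))
  refine (this.congr fun i => ?_).trans_eq ?_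
  · ring
  · congr 1; push_cast; ring

lemma charFun_map_sum_groups {Ω 𝓧 ι : Type*} [MeasurableSpace Ω] [MeasurableSpace 𝓧] [Fintype ι]
    {P : Measure Ω} {X : ι → ℕ → Ω → 𝓧} {Q : ι → Measure 𝓧}
    (hindep : iIndepFun (fun ik : ι × ℕ => X ik.1 ik.2) P) (hlaw : ∀ i k, HasLaw (X i k) (Q i) P)
    {f : ι → 𝓧 → ℝ} (hf : ∀ i, Measurable (f i)) (n : ι → ℕ) (u : ι → ℝ) :
    charFun (P.map (fun ω => ∑ i, u i * ∑ k ∈ Finset.range (n i), f i (X i k ω))) 1 =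
      ∏ i, charFun ((Q i).map (f i)) (u i) ^ n i := by
  -- The double sum is flattened over a sigma type, since the groups have different sizes; the
  -- product formula for independent families then applies once.
  let Y : (Σ i, Fin (n i)) → Ω → ℝ := fun p ω => u p.1 * f p.1 (X p.1 p.2 ω)
  have hX (i : ι) (k : ℕ) : AEMeasurable (fun ω => f i (X i k ω)) P :=
    (hf i).comp_aemeasurable (hlaw i k).aemeasurable
  have hY : iIndepFun Y P := by
    have h1 : iIndepFun (fun (p : Σ i, Fin (n i)) => X p.1 p.2) P :=
      hindep.precomp (g := fun p : Σ i, Fin (n i) => (p.1, (p.2 : ℕ))) (by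
        rintro ⟨i, k⟩ ⟨i', k'⟩ h
        simp only [Prod.mk.injEq] at h
        obtain ⟨rfl, h⟩ := h
        simpa [Fin.ext_iff] using h)
    exact h1.comp (fun p x => u p.1 * f p.1 x) (fun p => (hf p.1).const_mul _)
  have hYm (p : Σ i, Fin (n i)) : AEMeasurable (Y p) P := (hX p.1 p.2).const_mul _
  have hsum : (fun ω => ∑ i, u i * ∑ k ∈ Finset.range (n i), f i (X i k ω)) =
      fun ω => ∑ p, Y p ω := by
    ext ω
    simp only [Y, Fintype.sum_sigma, Finset.mul_sum]
    exact Finset.sum_congr rfl fun i _ =>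
      (Fin.sum_univ_eq_sum_range (fun k => u i * f i (X i k ω)) (n i)).symm
  rw [hsum, hY.charFun_map_fun_sum_eq_prod hYm,
    Finset.prod_apply, Fintype.prod_sigma]
  refine Finset.prod_congr rfl fun i _ => ?_
  have hfac (k : Fin (n i)) : charFun (P.map (Y ⟨i, k⟩)) 1 = charFun ((Q i).map (f i)) (u i) := by
    have : P.map (fun ω => f i (X i k ω)) = (Q i).map (f i) := by
      rw [← (hlaw i k).map_eq, AEMeasurable.map_map_of_aemeasurable (hf i).aemeasurable
        (hlaw i k).aemeasurable]
      rfl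
    simp only [Y]
    rw [charFun_map_mul_comp (hX i k), this, mul_one]
  simp [hfac]

/-- The characteristic functions at `1` of scaled sums of independent groups of centered
observations converge to that of a centered Gaussian variable. -/
lemma tendsto_charFun_map_sum_groups {Ω 𝓧 ι κ : Type*} [MeasurableSpace Ω] [MeasurableSpace 𝓧]
    [Fintype ι] {l : Filter κ} {P : Measure Ω} {X : ι → ℕ → Ω → 𝓧} {Q : ι → Measure 𝓧}
    [∀ i, IsProbabilityMeasure (Q i)]
    (hindep : iIndepFun (fun ik : ι × ℕ => X ik.1 ik.2) P) (hlaw : ∀ i k, HasLaw (X i k) (Q i) P)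
    {f : ι → 𝓧 → ℝ} (hf : ∀ i, Measurable (f i)) (hfL : ∀ i, MemLp (f i) 2 (Q i))
    (hf0 : ∀ i, ∫ x, f i x ∂(Q i) = 0) {n : κ → ι → ℕ} {u : κ → ι → ℝ} {s : ι → ℝ}
    (hn : ∀ i, Tendsto (fun m => n m i) l atTop)
    (hu : ∀ i, Tendsto (fun m => (n m i : ℝ) * u m i ^ 2) l (𝓝 (s i))) :
    Tendsto (fun m => charFun
        (P.map (fun ω => ∑ i, u m i * ∑ k ∈ Finset.range (n m i), f i (X i k ω))) 1) l
      (𝓝 (Complex.exp (-((∑ i, s i * Var[f i; Q i] : ℝ) / 2 : ℂ)))) := by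
  simp_rw [charFun_map_sum_groups hindep hlaw hf]
  have hlim : Complex.exp (-((∑ i, s i * Var[f i; Q i] : ℝ) / 2 : ℂ)) =
      ∏ i, Complex.exp (-((s i * Var[f i; Q i] : ℝ) / 2 : ℂ)) := by
    rw [← Complex.exp_sum, Finset.sum_neg_distrib, ← Finset.sum_div]
    push_cast
    rfl
  rw [hlim]
  refine tendsto_finsetProd _ fun i _ => ?_
  have : IsProbabilityMeasure ((Q i).map (f i)) :=
    Measure.isProbabilityMeasure_map (hf i).aemeasurable
  have hv : Var[f i; Q i] = ∫ x, x ^ 2 ∂((Q i).map (f i)) := by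
    rw [variance_of_integral_eq_zero (hf i).aemeasurable (hf0 i),
      integral_map (hf i).aemeasurable (by fun_prop)]
  rw [hv]
  refine tendsto_charFun_pow ?_ ?_ (hn i) (hu i)
  · exact (memLp_map_measure_iff (by fun_prop) (hf i).aemeasurable).2 (hfL i)
  · rw [integral_map (hf i).aemeasurable (by fun_prop)]
    exact hf0 i

end CentralLimit

/-! ### Moment bounds for completely degenerate two-sample sums -/

section DegenerateKernel

variable {Ω 𝓧 𝓨 ι : Type*} [MeasurableSpace Ω] [MeasurableSpace 𝓧] [MeasurableSpace 𝓨]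
  {P : Measure Ω} [IsProbabilityMeasure P]

lemma integral_comp_eq_zero_of_indepFun {U : Ω → 𝓧} {W : Ω → 𝓨} {μ : Measure 𝓧}
    [IsProbabilityMeasure μ] (hU : HasLaw U μ P) (hW : AEMeasurable W P) (hUW : IndepFun U W P)
    {g : 𝓧 → 𝓨 → ℝ} (hg : Measurable (Function.uncurry g)) (hg0 : ∀ w, ∫ u, g u w ∂μ = 0) :
    ∫ ω, g (U ω) (W ω) ∂P = 0 := by
  have : IsProbabilityMeasure (P.map W) := Measure.isProbabilityMeasure_map hW
  have hmap : P.map (fun ω => (U ω, W ω)) = μ.prod (P.map W) := by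
    rw [(indepFun_iff_map_prod_eq_prod_map_map hU.aemeasurable hW).1 hUW, hU.map_eq]
  have h1 : ∫ ω, g (U ω) (W ω) ∂P = ∫ z, Function.uncurry g z ∂(μ.prod (P.map W)) := by
    rw [← hmap, integral_map (hU.aemeasurable.prodMk hW) hg.aestronglyMeasurable]
    rfl
  rw [h1]
  by_cases hint : Integrable (Function.uncurry g) (μ.prod (P.map W))
  · rw [integral_prod_symm _ hint]
    simp [hg0]
  -- Without integrability the Bochner integral is 0 by convention.
  · exact integral_undef hint

variable [DecidableEq ι] {X : ι → ℕ → Ω → 𝓧} {Q : ι → Measure 𝓧} [∀ i, IsProbabilityMeasure (Q i)]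

/-- When `k ≠ k'`, the observation `X i k` occurs in the first factor only and is independent of the
others, so integrating it out first annihilates the product. The case `r = r'` is allowed. -/
lemma integral_mul_eq_zero_of_degenerate_left
    (hindep : iIndepFun (fun ik : ι × ℕ => X ik.1 ik.2) P) (hlaw : ∀ i k, HasLaw (X i k) (Q i) P)
    {i l : ι} (hil : i ≠ l) {h : 𝓧 → 𝓧 → ℝ} (hm : Measurable (Function.uncurry h))
    (h0 : ∀ y, ∫ x, h x y ∂(Q i) = 0) {k k' r r' : ℕ} (hk : k ≠ k') :
    ∫ ω, h (X i k ω) (X l r ω) * h (X i k' ω) (X l r' ω) ∂P = 0 := by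
  let S : Finset (ι × ℕ) := {(i, k)}
  let T : Finset (ι × ℕ) := {(i, k'), (l, r), (l, r')}
  have hST : Disjoint S T := by simp [S, T, hk, hil]
  have hXm (z : ι × ℕ) : AEMeasurable (X z.1 z.2) P := (hlaw z.1 z.2).aemeasurable
  have hproj : Measurable fun s : S → 𝓧 => s ⟨(i, k), by simp [S]⟩ := measurable_pi_apply _
  have hI := (hindep.indepFun_finset₀ S T hST hXm).comp hproj measurable_id
  have hh (a b : (T → 𝓧) → 𝓧) (ha : Measurable a) (hb : Measurable b) :
      Measurable fun w => h (a w) (b w) := hm.comp (ha.prodMk hb)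
  refine integral_comp_eq_zero_of_indepFun (hlaw i k) (W := fun ω (z : T) => X z.1.1 z.1.2 ω)
    (aemeasurable_pi_lambda _ fun z => hXm z.1) hI
    (g := fun x w => h x (w ⟨(l, r), by simp [T]⟩) *
      h (w ⟨(i, k'), by simp [T]⟩) (w ⟨(l, r'), by simp [T]⟩)) ?_ ?_
  · refine Measurable.mul ?_ ?_
    · exact hm.comp (measurable_fst.prodMk ((measurable_pi_apply _).comp measurable_snd))
    · exact (hh _ _ (measurable_pi_apply _) (measurable_pi_apply _)).comp measurable_snd
  · intro w
    rw [integral_mul_const, h0, zero_mul]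

/-- The second moment of a completely degenerate two-sample sum grows at most like the number of
its summands. -/
lemma integral_sq_sum_sum_le
    (hindep : iIndepFun (fun ik : ι × ℕ => X ik.1 ik.2) P) (hlaw : ∀ i k, HasLaw (X i k) (Q i) P)
    {i l : ι} (hil : i ≠ l) {h : 𝓧 → 𝓧 → ℝ} (hm : Measurable (Function.uncurry h))
    {C : ℝ} (hC : ∀ x y, |h x y| ≤ C) (h0 : ∀ y, ∫ x, h x y ∂(Q i) = 0)
    (h0' : ∀ x, ∫ y, h x y ∂(Q l) = 0) (p q : ℕ) :
    ∫ ω, (∑ k ∈ Finset.range p, ∑ r ∈ Finset.range q, h (X i k ω) (X l r ω)) ^ 2 ∂P ≤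
      C ^ 2 * (p * q) := by
  have hXm (i k) : AEMeasurable (X i k) P := (hlaw i k).aemeasurable
  have hD (z : ℕ × ℕ) : AEMeasurable (fun ω => h (X i z.1 ω) (X l z.2 ω)) P :=
    hm.comp_aemeasurable ((hXm i z.1).prodMk (hXm l z.2))
  have hbd (z z' : ℕ × ℕ) (ω : Ω) :
      |h (X i z.1 ω) (X l z.2 ω) * h (X i z'.1 ω) (X l z'.2 ω)| ≤ C ^ 2 := by
    rw [abs_mul, sq]
    exact mul_le_mul (hC _ _) (hC _ _) (abs_nonneg _)
      ((abs_nonneg _).trans (hC (X i z.1 ω) (X l z.2 ω)))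
  have hint (z z' : ℕ × ℕ) :
      Integrable (fun ω => h (X i z.1 ω) (X l z.2 ω) * h (X i z'.1 ω) (X l z'.2 ω)) P :=
    Integrable.of_bound ((hD z).mul (hD z')).aestronglyMeasurable (C ^ 2)
      (Eventually.of_forall fun ω => hbd z z' ω)
  have hle (z z' : ℕ × ℕ) :
      ∫ ω, h (X i z.1 ω) (X l z.2 ω) * h (X i z'.1 ω) (X l z'.2 ω) ∂P ≤
        if z = z' then C ^ 2 else 0 := by
    split_ifs with hz
    · calc _ ≤ ∫ _, C ^ 2 ∂P :=
            integral_mono (hint z z') (integrable_const _) fun ω => (le_abs_self _).trans (hbd z z' ω)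
        _ = C ^ 2 := by simp
    · by_cases hk : z.1 = z'.1
      · have hr : z.2 ≠ z'.2 := fun hr => hz (Prod.ext hk hr)
        -- Same first index but different second ones: the kernel with swapped arguments is used,
        -- and degeneracy in the second variable.
        exact (integral_mul_eq_zero_of_degenerate_left hindep hlaw hil.symm (h := fun y x => h x y)
          (hm.comp measurable_swap) h0' hr).le
      · exact (integral_mul_eq_zero_of_degenerate_left hindep hlaw hil hm h0 hk).le
  have hexp (ω : Ω) :
      (∑ k ∈ Finset.range p, ∑ r ∈ Finset.range q, h (X i k ω) (X l r ω)) ^ 2 =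
        ∑ z ∈ Finset.range p ×ˢ Finset.range q, ∑ z' ∈ Finset.range p ×ˢ Finset.range q,
          h (X i z.1 ω) (X l z.2 ω) * h (X i z'.1 ω) (X l z'.2 ω) := by
    rw [← Finset.sum_product' (f := fun k r => h (X i k ω) (X l r ω)), sq, Finset.sum_mul_sum]
  simp_rw [hexp]
  rw [integral_finsetSum _ fun z _ => integrable_finsetSum _ fun z' _ => hint z z']
  simp_rw [fun z => integral_finsetSum (Finset.range p ×ˢ Finset.range q) fun z' _ => hint z z']
  calc _ ≤ ∑ z ∈ Finset.range p ×ˢ Finset.range q, ∑ z' ∈ Finset.range p ×ˢ Finset.range q,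
        (if z = z' then C ^ 2 else 0) :=
      Finset.sum_le_sum fun z _ => Finset.sum_le_sum fun z' _ => hle z z'
    _ = C ^ 2 * (p * q) := by
      rw [Finset.sum_congr rfl fun z hz => by rw [Finset.sum_ite_eq, if_pos hz]]
      simp [mul_comm]

lemma integral_abs_le_sqrt_integral_sq {f : Ω → ℝ} (hf : MemLp f 2 P) :
    ∫ ω, |f ω| ∂P ≤ √(∫ ω, f ω ^ 2 ∂P) := by
  refine Real.le_sqrt_of_sq_le ?_
  -- `Var |f| ≥ 0` is exactly `(E|f|)² ≤ E f²`.
  have h := variance_nonneg (fun ω => |f ω|) P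
  rw [variance_eq_sub (by simpa using hf.norm)] at h
  simpa using h

lemma integral_abs_sum_sum_le
    (hindep : iIndepFun (fun ik : ι × ℕ => X ik.1 ik.2) P) (hlaw : ∀ i k, HasLaw (X i k) (Q i) P)
    {i l : ι} (hil : i ≠ l) {h : 𝓧 → 𝓧 → ℝ} (hm : Measurable (Function.uncurry h))
    {C : ℝ} (hC : ∀ x y, |h x y| ≤ C) (h0 : ∀ y, ∫ x, h x y ∂(Q i) = 0)
    (h0' : ∀ x, ∫ y, h x y ∂(Q l) = 0) (p q : ℕ) :
    ∫ ω, |∑ k ∈ Finset.range p, ∑ r ∈ Finset.range q, h (X i k ω) (X l r ω)| ∂P ≤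
      |C| * √(p * q) := by
  have hXm (i k) : AEMeasurable (X i k) P := (hlaw i k).aemeasurable
  have hL : MemLp (fun ω => ∑ k ∈ Finset.range p, ∑ r ∈ Finset.range q,
      h (X i k ω) (X l r ω)) 2 P :=
    memLp_finsetSum _ fun k _ => memLp_finsetSum _ fun r _ =>
      MemLp.of_bound (hm.comp_aemeasurable ((hXm i k).prodMk (hXm l r))).aestronglyMeasurable C
        (Eventually.of_forall fun ω => hC _ _)
  refine (integral_abs_le_sqrt_integral_sq hL).trans ?_
  rw [← Real.sqrt_sq_eq_abs, ← Real.sqrt_mul (sq_nonneg C)]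
  exact Real.sqrt_le_sqrt (integral_sq_sum_sum_le hindep hlaw hil hm hC h0 h0' p q)

end DegenerateKernel

/-! ### Normalized distribution functions and the Hoeffding decomposition of the kernel `c` -/

section NormalizedCDF

lemma c_nonneg (u : ℝ) : 0 ≤ c u := by unfold c; split_ifs <;> norm_num

lemma c_le_one (u : ℝ) : c u ≤ 1 := by unfold c; split_ifs <;> norm_num

lemma c_sub_comm (x y : ℝ) : c (y - x) = 1 - c (x - y) := by
  unfold c
  rcases lt_trichotomy x y with h | h | h
  · rw [if_pos (by linarith), if_neg (by linarith), if_neg (by linarith)]; norm_num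
  · subst h; norm_num
  · rw [if_neg (by linarith), if_neg (by linarith), if_pos (by linarith)]; norm_num

lemma measurable_c : Measurable c := by
  unfold c
  exact Measurable.ite (measurableSet_lt measurable_const measurable_id) measurable_const
    (Measurable.ite (measurableSet_eq_fun measurable_id measurable_const) measurable_const
      measurable_const)

lemma normCDF_nonneg (μ : Measure ℝ) (x : ℝ) : 0 ≤ normCDF μ x := by
  unfold normCDF; positivity

variable (μ ν : Measure ℝ) [IsProbabilityMeasure μ] [IsProbabilityMeasure ν]

lemma integrable_c_sub_left (x : ℝ) : Integrable (fun y => c (x - y)) μ :=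
  Integrable.of_bound (measurable_c.comp (by fun_prop)).aestronglyMeasurable 1
    (Eventually.of_forall fun y => by
      rw [Real.norm_eq_abs, abs_of_nonneg (c_nonneg _)]; exact c_le_one _)

/-- Pointwise, `c (x - y)` is the mean of the indicators of `y < x` and `y ≤ x`; hence the
normalized distribution function is a conditional expectation of the kernel, ties included. -/
lemma normCDF_eq_integral (x : ℝ) : normCDF μ x = ∫ y, c (x - y) ∂μ := by
  have h (y : ℝ) : c (x - y) =
      ((Set.Iio x).indicator 1 y + (Set.Iic x).indicator 1 y) / 2 := by
    unfold c
    rcases lt_trichotomy x y with h | h | h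
    · rw [if_neg (by linarith), if_neg (by linarith)]
      simp [h.not_gt, h.not_ge]
    · subst h; simp
    · rw [if_pos (by linarith)]
      simp [h, h.le]
  simp_rw [h]
  have hind {s : Set ℝ} (hs : MeasurableSet s) :
      Integrable (fun y => s.indicator (1 : ℝ → ℝ) y) μ := (integrable_const (1 : ℝ)).indicator hs
  rw [integral_div, integral_add (hind measurableSet_Iio) (hind measurableSet_Iic),
    integral_indicator_one measurableSet_Iio, integral_indicator_one measurableSet_Iic]
  rfl

lemma integral_c_sub_right (y : ℝ) : ∫ x, c (x - y) ∂μ = 1 - normCDF μ y := by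
  rw [normCDF_eq_integral]
  simp_rw [fun x => c_sub_comm y x]
  rw [integral_sub (integrable_const _) (integrable_c_sub_left μ y)]
  simp

lemma normCDF_le_one (x : ℝ) : normCDF μ x ≤ 1 := by
  unfold normCDF
  have h1 : μ.real (Set.Iio x) ≤ 1 := measureReal_le_one
  have h2 : μ.real (Set.Iic x) ≤ 1 := measureReal_le_one
  linarith

lemma measurable_normCDF : Measurable (normCDF μ) := by
  refine Monotone.measurable fun x y h => ?_
  unfold normCDF
  have h1 : μ.real (Set.Iio x) ≤ μ.real (Set.Iio y) := measureReal_mono (Set.Iio_subset_Iio h)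
  have h2 : μ.real (Set.Iic x) ≤ μ.real (Set.Iic y) := measureReal_mono (Set.Iic_subset_Iic.2 h)
  linarith

lemma norm_normCDF_le (x : ℝ) : ‖normCDF μ x‖ ≤ 1 := by
  rw [Real.norm_eq_abs, abs_of_nonneg (normCDF_nonneg μ x)]
  exact normCDF_le_one μ x

lemma integrable_normCDF : Integrable (normCDF μ) ν :=
  Integrable.of_bound (measurable_normCDF μ).aestronglyMeasurable 1
    (Eventually.of_forall (norm_normCDF_le μ))

/-- Fubini combined with `c (x - y) + c (y - x) = 1`. -/
lemma integral_normCDF_add_integral_normCDF :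
    ∫ x, normCDF μ x ∂ν + ∫ y, normCDF ν y ∂μ = 1 := by
  have hint : Integrable (Function.uncurry fun x y : ℝ => c (x - y)) (ν.prod μ) :=
    Integrable.of_bound (measurable_c.comp (by fun_prop)).aestronglyMeasurable 1
      (Eventually.of_forall fun y => by
        rw [Real.norm_eq_abs, Function.uncurry, abs_of_nonneg (c_nonneg _)]; exact c_le_one _)
  have h : ∫ x, normCDF μ x ∂ν = ∫ y, (1 - normCDF ν y) ∂μ := by
    simp_rw [normCDF_eq_integral μ, ← integral_c_sub_right ν]
    exact integral_integral_swap hint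
  rw [h, integral_sub (integrable_const _) (integrable_normCDF ν μ)]
  simp

/-- The completely degenerate part of the Mann-Whitney kernel `c (x - y)`, for `x` with law `ν` and
`y` with law `μ`. -/
noncomputable def degenerateKernel (μ ν : Measure ℝ) (x y : ℝ) : ℝ :=
  c (x - y) - normCDF μ x + (normCDF ν y - ∫ z, normCDF ν z ∂μ)

lemma measurable_degenerateKernel : Measurable (Function.uncurry (degenerateKernel μ ν)) := by
  have h1 : Measurable fun z : ℝ × ℝ => c (z.1 - z.2) := measurable_c.comp (by fun_prop)
  have h2 : Measurable fun z : ℝ × ℝ => normCDF μ z.1 := (measurable_normCDF μ).comp measurable_fst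
  have h3 : Measurable fun z : ℝ × ℝ => normCDF ν z.2 := (measurable_normCDF ν).comp measurable_snd
  exact (h1.sub h2).add (h3.sub_const _)

lemma abs_degenerateKernel_le (x y : ℝ) : |degenerateKernel μ ν x y| ≤ 2 := by
  have h1 : 0 ≤ ∫ z, normCDF ν z ∂μ := integral_nonneg (normCDF_nonneg ν)
  have h2 : ∫ z, normCDF ν z ∂μ ≤ 1 := by
    have := integral_normCDF_add_integral_normCDF μ ν
    have h3 : 0 ≤ ∫ z, normCDF μ z ∂ν := integral_nonneg (normCDF_nonneg μ)
    linarith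
  have := c_nonneg (x - y)
  have := c_le_one (x - y)
  have := normCDF_nonneg μ x
  have := normCDF_le_one μ x
  have := normCDF_nonneg ν y
  have := normCDF_le_one ν y
  unfold degenerateKernel
  rw [abs_le]
  constructor <;> linarith

lemma integral_degenerateKernel_right (x : ℝ) : ∫ y, degenerateKernel μ ν x y ∂μ = 0 := by
  unfold degenerateKernel
  rw [integral_add (f := fun y => c (x - y) - normCDF μ x)
      (g := fun y => normCDF ν y - ∫ z, normCDF ν z ∂μ)
      ((integrable_c_sub_left μ x).sub (integrable_const _))
      ((integrable_normCDF ν μ).sub (integrable_const _)),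
    integral_sub (integrable_c_sub_left μ x) (integrable_const _),
    integral_sub (integrable_normCDF ν μ) (integrable_const _), normCDF_eq_integral μ]
  simp

lemma integral_degenerateKernel_left (y : ℝ) : ∫ x, degenerateKernel μ ν x y ∂ν = 0 := by
  have hc : Integrable (fun x => c (x - y)) ν := by
    simp_rw [fun x => c_sub_comm y x]
    exact (integrable_const _).sub (integrable_c_sub_left ν y)
  unfold degenerateKernel
  rw [integral_add (f := fun x => c (x - y) - normCDF μ x) (hc.sub (integrable_normCDF μ ν)) (integrable_const _),
    integral_sub hc (integrable_normCDF μ ν), integral_c_sub_right, integral_const]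
  have := integral_normCDF_add_integral_normCDF μ ν
  simp only [probReal_univ, one_smul]
  linarith

/-- For equal laws the mean effect is `1 / 2`, so the kernel inherits the antisymmetry of `c - 1 /
2`. -/
lemma degenerateKernel_self_antisymm (x y : ℝ) :
    degenerateKernel μ μ y x = -degenerateKernel μ μ x y := by
  have := integral_normCDF_add_integral_normCDF μ μ
  unfold degenerateKernel
  rw [c_sub_comm x y]
  linarith

end NormalizedCDF

/-! ### The linear projection and its covariance matrix -/

section Projection

variable {a d : ℕ} (Q : Fin a → Measure (Fin d → ℝ))

/-- The Mann-Whitney effect `∫ F_{lj} dF_{ij}` of the groups `l` and `i` in component `j`. -/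
noncomputable def pairEffect (l i : Fin a) (j : Fin d) : ℝ := ∫ x, F Q l j x ∂(marginal Q i j)

/-- The contribution of an observation `x` of group `g` to the projection of the estimated
Mann-Whitney effect of the groups `l` and `i` in component `j`. -/
noncomputable def pairInfluence (l i : Fin a) (j : Fin d) (g : Fin a) (x : Fin d → ℝ) : ℝ :=
  (if g = i then F Q l j (x j) - pairEffect Q l i j else 0)
    - (if g = l then F Q i j (x j) - pairEffect Q i l j else 0)

/-- The contribution of an observation `x` of group `g` to the projection of the estimated
effects. -/
noncomputable def influence (g : Fin a) (x : Fin d → ℝ) (h : Fin a × Fin d) : ℝ :=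
  (1 / (a : ℝ)) * ∑ l : Fin a, pairInfluence Q l h.1 h.2 g x

lemma integral_marginal {f : ℝ → ℝ} (hf : Measurable f) (i : Fin a) (j : Fin d) :
    ∫ y, f y ∂(marginal Q i j) = ∫ x, f (x j) ∂(Q i) :=
  integral_map (measurable_pi_apply j).aemeasurable hf.aestronglyMeasurable

variable [∀ i, IsProbabilityMeasure (Q i)]

instance isProbabilityMeasure_marginal (i : Fin a) (j : Fin d) :
    IsProbabilityMeasure (marginal Q i j) :=
  Measure.isProbabilityMeasure_map (measurable_pi_apply j).aemeasurable

lemma measurable_F (i : Fin a) (j : Fin d) : Measurable (F Q i j) := measurable_normCDF _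

lemma memLp_F_eval (g i : Fin a) (j : Fin d) : MemLp (fun x : Fin d → ℝ => F Q i j (x j)) 2 (Q g) :=
  MemLp.of_bound ((measurable_F Q i j).comp (measurable_pi_apply j)).aestronglyMeasurable 1
    (Eventually.of_forall fun _ => norm_normCDF_le _ _)

lemma integrable_F_eval (g i : Fin a) (j : Fin d) :
    Integrable (fun x : Fin d → ℝ => F Q i j (x j)) (Q g) :=
  (memLp_F_eval Q g i j).integrable (by norm_num)

lemma integral_F_eval_sub (g i : Fin a) (j : Fin d) :
    ∫ x, (F Q i j (x j) - pairEffect Q i g j) ∂(Q g) = 0 := by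
  rw [integral_sub (integrable_F_eval Q g i j) (integrable_const _), pairEffect,
    integral_marginal Q (measurable_F Q i j)]
  simp

lemma integrable_F (g i : Fin a) (j j' : Fin d) : Integrable (F Q i j) (marginal Q g j') :=
  integrable_normCDF _ _

lemma effect_eq (h : Fin a × Fin d) :
    effect Q h = (1 / (a : ℝ)) * ∑ l, pairEffect Q l h.1 h.2 := by
  unfold effect G pairEffect
  rw [integral_const_mul, integral_finsetSum _ fun i _ => integrable_F Q _ i _ _]

lemma memLp_ite_F (g i l : Fin a) (j : Fin d) (e : ℝ) :
    MemLp (fun x : Fin d → ℝ => if g = i then F Q l j (x j) - e else 0) 2 (Q g) := by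
  split_ifs
  · exact (memLp_F_eval Q g l j).sub (memLp_const _)
  · exact MemLp.zero

lemma measurable_pairInfluence (l i : Fin a) (j : Fin d) (g : Fin a) :
    Measurable (pairInfluence Q l i j g) := by
  have hF (i : Fin a) : Measurable fun x : Fin d → ℝ => F Q i j (x j) :=
    (measurable_F Q i j).comp (measurable_pi_apply _)
  unfold pairInfluence
  refine Measurable.sub ?_ ?_
  · split_ifs
    · exact (hF l).sub_const _
    · exact measurable_const
  · split_ifs
    · exact (hF i).sub_const _
    · exact measurable_const

lemma memLp_pairInfluence (l i : Fin a) (j : Fin d) (g : Fin a) :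
    MemLp (pairInfluence Q l i j g) 2 (Q g) :=
  (memLp_ite_F Q g i l j _).sub (memLp_ite_F Q g l i j _)

lemma integral_pairInfluence (l i : Fin a) (j : Fin d) (g : Fin a) :
    ∫ x, pairInfluence Q l i j g x ∂(Q g) = 0 := by
  have h1 (i l : Fin a) :
      ∫ x : Fin d → ℝ, (if g = i then F Q l j (x j) - pairEffect Q l i j else 0) ∂(Q g) = 0 := by
    split_ifs with hg
    · subst hg; exact integral_F_eval_sub Q g l j
    · simp
  have h2 (i l : Fin a) (e : ℝ) := (memLp_ite_F Q g i l j e).integrable (by norm_num)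
  unfold pairInfluence
  rw [integral_sub (h2 _ _ _) (h2 _ _ _), h1, h1, sub_zero]

lemma measurable_influence (g : Fin a) (h : Fin a × Fin d) :
    Measurable fun x => influence Q g x h :=
  (Finset.measurable_fun_sum _ fun l _ => measurable_pairInfluence Q l h.1 h.2 g).const_mul _

lemma memLp_influence (g : Fin a) (h : Fin a × Fin d) :
    MemLp (fun x => influence Q g x h) 2 (Q g) :=
  (memLp_finsetSum _ fun l _ => memLp_pairInfluence Q l h.1 h.2 g).const_mul _

lemma integral_influence (g : Fin a) (h : Fin a × Fin d) :
    ∫ x, influence Q g x h ∂(Q g) = 0 := by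
  unfold influence
  rw [integral_const_mul, integral_finsetSum _ fun l _ =>
    (memLp_pairInfluence Q l h.1 h.2 g).integrable (by norm_num)]
  simp [integral_pairInfluence]

lemma covariance_ite_F (g i i' l l' : Fin a) (j j' : Fin d) (e e' : ℝ) :
    cov[fun x : Fin d → ℝ => if g = i then F Q l j (x j) - e else 0,
      fun x : Fin d → ℝ => if g = i' then F Q l' j' (x j') - e' else 0; Q g] =
      if g = i then (if g = i' then covF Q g l j l' j' else 0) else 0 := by
  split_ifs
  · rw [covariance_sub_const_left (integrable_F_eval Q g l j),
      covariance_sub_const_right (integrable_F_eval Q g l' j')]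
    rfl
  all_goals simp

/-- Each influence is a difference of two terms carrying group indicators. Bilinearity gives four
products of indicators, and summing over `g` turns them into the four Kronecker terms of `sigmaW`;
the centering constants do not affect covariances. -/
lemma sum_covariance_influence (lam : Fin a → ℝ) (h h' : Fin a × Fin d) :
    ∑ g, (1 / lam g) * cov[fun x => influence Q g x h, fun x => influence Q g x h'; Q g] =
      Sigma Q lam h h' := by
  have hcov (g : Fin a) :
      cov[fun x => influence Q g x h, fun x => influence Q g x h'; Q g] =
        (1 / (a : ℝ) ^ 2) * ∑ l, ∑ l',
          ((if g = h.1 then (if g = h'.1 then covF Q g l h.2 l' h'.2 else 0) else 0)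
          - (if g = h.1 then (if g = l' then covF Q g l h.2 h'.1 h'.2 else 0) else 0)
          - (if g = l then (if g = h'.1 then covF Q g h.1 h.2 l' h'.2 else 0) else 0)
          + (if g = l then (if g = l' then covF Q g h.1 h.2 h'.1 h'.2 else 0) else 0)) := by
    unfold influence
    rw [covariance_const_mul_left, covariance_const_mul_right, covariance_fun_sum_fun_sum
      (fun l => memLp_pairInfluence Q l h.1 h.2 g) (fun l => memLp_pairInfluence Q l h'.1 h'.2 g),
      ← mul_assoc, ← sq, _root_.one_div_pow]
    congr 1
    refine Finset.sum_congr rfl fun l _ => Finset.sum_congr rfl fun l' _ => ?_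
    unfold pairInfluence
    rw [covariance_fun_sub_fun_sub (memLp_ite_F Q g h.1 l h.2 _) (memLp_ite_F Q g l h.1 h.2 _)
      (memLp_ite_F Q g h'.1 l' h'.2 _) (memLp_ite_F Q g l' h'.1 h'.2 _)]
    simp only [covariance_ite_F]
  simp_rw [hcov, Sigma, mul_left_comm _ (1 / (a : ℝ) ^ 2), ← Finset.mul_sum]
  congr 1
  simp_rw [Finset.mul_sum]
  rw [Finset.sum_comm]
  refine Finset.sum_congr rfl fun l _ => ?_
  rw [Finset.sum_comm]
  refine Finset.sum_congr rfl fun l' _ => ?_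
  simp only [mul_add, mul_sub, Finset.sum_add_distrib, Finset.sum_sub_distrib, mul_ite, mul_zero,
    Finset.sum_ite_eq', Finset.mem_univ, if_true]
  unfold sigmaW
  ring

/-- This is the limiting variance in direction `t`; it serves both positive semidefiniteness and the
identification of the Gaussian limit. -/
lemma dotProduct_Sigma_mulVec (lam : Fin a → ℝ) (t : Fin a × Fin d → ℝ) :
    t ⬝ᵥ (Sigma Q lam *ᵥ t) =
      ∑ g, (1 / lam g) * Var[fun x => ∑ h, t h * influence Q g x h; Q g] := by
  have hvar (g : Fin a) : Var[fun x => ∑ h, t h * influence Q g x h; Q g] =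
      ∑ h, ∑ h', t h * (t h' * cov[fun x => influence Q g x h, fun x => influence Q g x h'; Q g]) := by
    rw [← covariance_self (Finset.measurable_fun_sum _ fun h _ =>
        (measurable_influence Q g h).const_mul _).aemeasurable,
      covariance_fun_sum_fun_sum (fun h => (memLp_influence Q g h).const_mul _)
        (fun h => (memLp_influence Q g h).const_mul _)]
    simp_rw [covariance_const_mul_left, covariance_const_mul_right]
  simp_rw [hvar, Finset.mul_sum, dotProduct, mulVec, dotProduct, ← sum_covariance_influence,
    Finset.sum_mul, Finset.mul_sum]
  rw [Finset.sum_comm (s := Finset.univ (α := Fin a))]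
  refine Finset.sum_congr rfl fun h _ => ?_
  rw [Finset.sum_comm]
  exact Finset.sum_congr rfl fun g _ => Finset.sum_congr rfl fun h' _ => by ring

lemma posSemidef_Sigma {lam : Fin a → ℝ} (hlam : ∀ i, 0 ≤ lam i) : (Sigma Q lam).PosSemidef := by
  refine PosSemidef.of_dotProduct_mulVec_nonneg ?_ fun t => ?_
  · ext h h'
    simp only [conjTranspose_apply, star_trivial, ← sum_covariance_influence]
    exact Finset.sum_congr rfl fun g _ => by rw [covariance_comm]
  · rw [star_trivial, dotProduct_Sigma_mulVec]
    exact Finset.sum_nonneg fun g _ =>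
      mul_nonneg (one_div_nonneg.2 (hlam g)) (variance_nonneg _ _)

end Projection

/-! ### Hoeffding decomposition of the estimators -/

section Decomposition

variable {Ω : Type*} {a d : ℕ} (X : Fin a → ℕ → Ω → Fin d → ℝ) (Q : Fin a → Measure (Fin d → ℝ))
  (n : Fin a → ℕ)

/-- The difference of the estimated Mann-Whitney effect and its projection. -/
noncomputable def pairRemainder (l i : Fin a) (j : Fin d) (ω : Ω) : ℝ :=
  (1 / (n l : ℝ)) * (1 / (n i : ℝ)) * ∑ k ∈ Finset.range (n i), ∑ r ∈ Finset.range (n l),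
    degenerateKernel (marginal Q l j) (marginal Q i j) (X i k ω j) (X l r ω j)

/-- Purely algebraic: averaging the definition of `degenerateKernel` over all pairs. Nonempty
samples are needed for the averages of constants. -/
lemma wHat_sub_pairEffect (hn : ∀ i, n i ≠ 0) (l i : Fin a) (j : Fin d) (ω : Ω) :
    wHat X n l i j ω - pairEffect Q l i j =
      (1 / (n i : ℝ)) * ∑ k ∈ Finset.range (n i), (F Q l j (X i k ω j) - pairEffect Q l i j)
      - (1 / (n l : ℝ)) * ∑ r ∈ Finset.range (n l), (F Q i j (X l r ω j) - pairEffect Q i l j)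
      + pairRemainder X Q n l i j ω := by
  have hi : (n i : ℝ) ≠ 0 := by exact_mod_cast hn i
  have hl : (n l : ℝ) ≠ 0 := by exact_mod_cast hn l
  have hker (x y : ℝ) : degenerateKernel (marginal Q l j) (marginal Q i j) x y =
      c (x - y) - F Q l j x + (F Q i j y - pairEffect Q i l j) := rfl
  unfold wHat pairRemainder
  simp only [hker, Finset.sum_add_distrib, Finset.sum_sub_distrib, Finset.sum_const,
    Finset.card_range, nsmul_eq_mul, ← Finset.mul_sum]
  field_simp
  ring

variable [∀ i, IsProbabilityMeasure (Q i)]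

/-- Both samples coincide here, so independence is not available; instead, exchanging the summation
indices shows that the antisymmetric double sum equals its own negative. -/
lemma pairRemainder_self (i : Fin a) (j : Fin d) (ω : Ω) : pairRemainder X Q n i i j ω = 0 := by
  have h : ∑ k ∈ Finset.range (n i), ∑ r ∈ Finset.range (n i),
      degenerateKernel (marginal Q i j) (marginal Q i j) (X i k ω j) (X i r ω j) =
      -∑ k ∈ Finset.range (n i), ∑ r ∈ Finset.range (n i),
      degenerateKernel (marginal Q i j) (marginal Q i j) (X i k ω j) (X i r ω j) := by
    conv_lhs => rw [Finset.sum_comm]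
    simp_rw [← Finset.sum_neg_distrib]
    exact Finset.sum_congr rfl fun k _ => Finset.sum_congr rfl fun r _ =>
      degenerateKernel_self_antisymm _ _ _
  unfold pairRemainder
  rw [self_eq_neg.1 h, mul_zero]

lemma pHat_sub_effect (hn : ∀ i, n i ≠ 0) (h : Fin a × Fin d) (ω : Ω) :
    pHat X n ω h - effect Q h =
      ∑ g, (1 / (n g : ℝ)) * ∑ k ∈ Finset.range (n g), influence Q g (X g k ω) h
      + (1 / (a : ℝ)) * ∑ l, pairRemainder X Q n l h.1 h.2 ω := by
  have hproj : ∑ g, (1 / (n g : ℝ)) * ∑ k ∈ Finset.range (n g), influence Q g (X g k ω) h =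
      (1 / (a : ℝ)) * ∑ l,
      ((1 / (n h.1 : ℝ)) * ∑ k ∈ Finset.range (n h.1),
        (F Q l h.2 (X h.1 k ω h.2) - pairEffect Q l h.1 h.2)
      - (1 / (n l : ℝ)) * ∑ r ∈ Finset.range (n l),
        (F Q h.1 h.2 (X l r ω h.2) - pairEffect Q h.1 l h.2)) := by
    unfold influence pairInfluence
    have hg (g : Fin a) : (1 / (n g : ℝ)) * ∑ k ∈ Finset.range (n g), ((1 / (a : ℝ)) * ∑ l : Fin a,
        ((if g = h.1 then F Q l h.2 (X g k ω h.2) - pairEffect Q l h.1 h.2 else 0)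
        - (if g = l then F Q h.1 h.2 (X g k ω h.2) - pairEffect Q h.1 l h.2 else 0))) =
        (1 / (a : ℝ)) * ∑ l,
        ((if g = h.1 then (1 / (n g : ℝ)) * ∑ k ∈ Finset.range (n g),
            (F Q l h.2 (X g k ω h.2) - pairEffect Q l h.1 h.2) else 0)
        - (if g = l then (1 / (n g : ℝ)) * ∑ k ∈ Finset.range (n g),
            (F Q h.1 h.2 (X g k ω h.2) - pairEffect Q h.1 l h.2) else 0)) := by
      rw [← Finset.mul_sum, mul_left_comm, Finset.sum_comm, Finset.mul_sum]
      congr 1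
      refine Finset.sum_congr rfl fun l _ => ?_
      rw [Finset.sum_sub_distrib, mul_sub]
      congr 1 <;> split_ifs <;> simp
    rw [Finset.sum_congr rfl fun g _ => hg g, ← Finset.mul_sum, Finset.sum_comm]
    congr 1
    refine Finset.sum_congr rfl fun l _ => ?_
    rw [Finset.sum_sub_distrib]
    simp
  rw [hproj, effect_eq, pHat, ← mul_sub, ← Finset.sum_sub_distrib, ← mul_add,
    ← Finset.sum_add_distrib]
  congr 1
  exact Finset.sum_congr rfl fun l _ => wHat_sub_pairEffect X Q n hn l h.1 h.2 ω

end Decomposition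

/-! ### Quadratic forms in Gaussian vectors -/

section QuadraticForm

/-- A quadratic form in a standard Gaussian vector is distributed as the sum of independent
squared standard normal variables, weighted with the eigenvalues of the form. -/
lemma map_quadraticForm_stdGaussian {ι : Type*} [Fintype ι] [DecidableEq ι] {A : Matrix ι ι ℝ}
    (hA : A.IsHermitian) :
    (stdGaussian (EuclideanSpace ℝ ι)).map (fun x => x.ofLp ⬝ᵥ (A *ᵥ x.ofLp)) =
      (Measure.pi fun _ : ι => gaussianReal 0 1).map
        (fun y => ∑ h, hA.eigenvalues h * y h ^ 2) := by
  -- The standard Gaussian law has independent standard normal coordinates in every orthonormal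
  -- basis, in particular in the eigenbasis of `A`.
  rw [stdGaussian_eq_map_pi_orthonormalBasis hA.eigenvectorBasis,
    Measure.map_map (by fun_prop) (by fun_prop)]
  congr 1
  ext y
  have horth (h h' : ι) : (hA.eigenvectorBasis h).ofLp ⬝ᵥ (hA.eigenvectorBasis h').ofLp =
      if h = h' then 1 else 0 := by
    have := orthonormal_iff_ite.1 hA.eigenvectorBasis.orthonormal h' h
    rw [EuclideanSpace.inner_eq_star_dotProduct, star_trivial] at this
    rw [this]
    simp [eq_comm]
  simp only [Function.comp_apply, WithLp.ofLp_sum, WithLp.ofLp_smul, mulVec_sum, mulVec_smul,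
    hA.mulVec_eigenvectorBasis, sum_dotProduct, dotProduct_sum, smul_dotProduct, dotProduct_smul,
    horth, smul_eq_mul, mul_ite, mul_one, mul_zero, Finset.sum_ite_eq', Finset.mem_univ, if_true]
  exact Finset.sum_congr rfl fun h _ => by ring

lemma identDistrib_quadraticForm {Ω' Ω'' ι : Type*} [MeasurableSpace Ω'] [MeasurableSpace Ω'']
    {P' : Measure Ω'} {P'' : Measure Ω''} [Fintype ι] [DecidableEq ι] {S T : Matrix ι ι ℝ}
    (hA : (CFC.sqrt S * T * CFC.sqrt S).IsHermitian)
    {Z : Ω' → EuclideanSpace ℝ ι} (hZ : HasLaw Z (multivariateGaussian 0 S) P')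
    {Y : ι → Ω'' → ℝ} (hYindep : iIndepFun Y P'') (hYlaw : ∀ h, HasLaw (Y h) (gaussianReal 0 1) P'') :
    IdentDistrib (fun ω => (Z ω).ofLp ⬝ᵥ (T *ᵥ (Z ω).ofLp))
      (fun ω => ∑ h, hA.eigenvalues h * (Y h ω) ^ 2) P' P'' := by
  have hq (A : Matrix ι ι ℝ) :
      Measurable fun x : EuclideanSpace ℝ ι => x.ofLp ⬝ᵥ (A *ᵥ x.ofLp) := by fun_prop
  have hY := hYindep.hasLaw_pi hYlaw
  have hr : Measurable fun y : ι → ℝ => ∑ h, hA.eigenvalues h * y h ^ 2 := by fun_prop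
  refine ⟨(hq T).comp_aemeasurable hZ.aemeasurable, hr.comp_aemeasurable hY.aemeasurable, ?_⟩
  have h1 : P'.map (fun ω => (Z ω).ofLp ⬝ᵥ (T *ᵥ (Z ω).ofLp)) =
      (multivariateGaussian 0 S).map fun x => x.ofLp ⬝ᵥ (T *ᵥ x.ofLp) := by
    rw [← hZ.map_eq, AEMeasurable.map_map_of_aemeasurable (hq T).aemeasurable hZ.aemeasurable]
    rfl
  have h2 : P''.map (fun ω => ∑ h, hA.eigenvalues h * (Y h ω) ^ 2) =
      (Measure.pi fun _ : ι => gaussianReal 0 1).map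
        (fun y => ∑ h, hA.eigenvalues h * y h ^ 2) := by
    rw [← hY.map_eq, AEMeasurable.map_map_of_aemeasurable hr.aemeasurable hY.aemeasurable]
    rfl
  have hsymm : (CFC.sqrt S)ᵀ = CFC.sqrt S := by
    have := (CFC.sqrt_nonneg S).isSelfAdjoint
    rwa [isSelfAdjoint_iff, star_eq_conjTranspose, conjTranspose_eq_transpose_of_trivial] at this
  -- `multivariateGaussian 0 S` is by definition the image of the standard Gaussian under `√S`;
  -- symmetry of `√S` moves it to the other side of the form.
  rw [h1, h2, ← map_quadraticForm_stdGaussian hA, multivariateGaussian,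
    Measure.map_map (hq T) (by fun_prop)]
  congr 1
  ext x
  simp only [Function.comp_apply, zero_add, ofLp_toEuclideanCLM]
  rw [← mulVec_mulVec, ← mulVec_mulVec, dotProduct_mulVec x.ofLp, ← mulVec_transpose, hsymm]

/-- Since `T = Tᴴ T`, the matrix is the Gram matrix of `T √S`. -/
lemma posSemidef_sqrt_mul_mul_sqrt {ι : Type*} [Fintype ι] [DecidableEq ι] (S : Matrix ι ι ℝ)
    {T : Matrix ι ι ℝ} (hTsymm : T.IsSymm) (hTidem : IsIdempotentElem T) :
    (CFC.sqrt S * T * CFC.sqrt S).PosSemidef := by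
  have hS : (CFC.sqrt S)ᴴ = CFC.sqrt S := (CFC.sqrt_nonneg S).isSelfAdjoint
  have hT : Tᴴ = T := by rw [conjTranspose_eq_transpose_of_trivial]; exact hTsymm
  have h := posSemidef_conjTranspose_mul_self (T * CFC.sqrt S)
  rw [conjTranspose_mul, hS, hT] at h
  have e : CFC.sqrt S * T * CFC.sqrt S = CFC.sqrt S * T * (T * CFC.sqrt S) := by
    rw [Matrix.mul_assoc, Matrix.mul_assoc, ← Matrix.mul_assoc T T, hTidem.eq]
  rwa [e]

end QuadraticForm

/-! ### Negligibility of the remainder and the weak limit -/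

section Limit

variable {Ω : Type*} [MeasurableSpace Ω] {P : Measure Ω}

/-- The Cramér-Wold reduction: a vector characteristic function becomes a scalar one at 1. -/
lemma charFun_map_eq_charFun_map_inner {E : Type*} [NormedAddCommGroup E] [InnerProductSpace ℝ E]
    [MeasurableSpace E] [BorelSpace E] [SecondCountableTopology E] {V : Ω → E}
    (hV : AEMeasurable V P) (t : E) :
    charFun (P.map V) t = charFun (P.map fun ω => inner ℝ (V ω) t) 1 := by
  rw [charFun_apply, charFun_apply_real, integral_map hV (by fun_prop),
    integral_map (by fun_prop) (by fun_prop)]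
  simp

/-- From `|exp(iA) - exp(iB)| ≤ |A - B|`. It plays the role of Slutsky's lemma: a remainder that is
small in `L¹` does not change the limit. -/
lemma norm_charFun_map_sub_le [IsProbabilityMeasure P] {A B : Ω → ℝ} (hA : AEMeasurable A P) (hB : AEMeasurable B P)
    (hAB : Integrable (fun ω => A ω - B ω) P) :
    ‖charFun (P.map A) 1 - charFun (P.map B) 1‖ ≤ ∫ ω, |A ω - B ω| ∂P := by
  have hexp {A : Ω → ℝ} (hA : AEMeasurable A P) :
      charFun (P.map A) 1 = ∫ ω, Complex.exp (A ω * Complex.I) ∂P ∧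
        Integrable (fun ω => Complex.exp (A ω * Complex.I)) P := by
    have hm : AEStronglyMeasurable (fun ω => Complex.exp (A ω * Complex.I)) P :=
      AEMeasurable.aestronglyMeasurable (by fun_prop)
    refine ⟨?_, Integrable.of_bound hm 1 (Eventually.of_forall fun ω => ?_)⟩
    · rw [charFun_apply_real, integral_map hA (by fun_prop)]
      simp
    · rw [Complex.norm_exp_ofReal_mul_I]
  rw [(hexp hA).1, (hexp hB).1, ← integral_sub (hexp hA).2 (hexp hB).2]
  refine norm_integral_le_of_norm_le hAB.abs (Eventually.of_forall fun ω => ?_)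
  have h1 : Complex.exp (A ω * Complex.I) - Complex.exp (B ω * Complex.I) =
      Complex.exp (B ω * Complex.I) *
        (Complex.exp (Complex.I * ((A ω - B ω : ℝ) : ℂ)) - 1) := by
    rw [mul_sub, ← Complex.exp_add]
    push_cast
    ring_nf
  rw [h1, norm_mul, Complex.norm_exp_ofReal_mul_I, one_mul]
  exact Real.norm_exp_I_mul_ofReal_sub_one_le

variable {a d : ℕ} {n : ℕ → Fin a → ℕ} {lam : Fin a → ℝ}

lemma SampleSizeCondition.tendsto_atTop (hn : SampleSizeCondition n lam) (i : Fin a) :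
    Tendsto (fun m => n m i) atTop atTop := by
  have hN : Tendsto (fun m => (total (n m) : ℝ)) atTop atTop :=
    tendsto_natCast_atTop_atTop.comp hn.total_tendsto
  have h := (hn.ratio_tendsto i).pos_mul_atTop (hn.lam_mem i).1 hN
  refine (tendsto_natCast_atTop_iff (R := ℝ)).1 (h.congr' ?_)
  filter_upwards [hN.eventually_ne_atTop 0] with m hm
  exact div_mul_cancel₀ _ hm

lemma SampleSizeCondition.tendsto_total_div (hn : SampleSizeCondition n lam) (i : Fin a) :
    Tendsto (fun m => (total (n m) : ℝ) / (n m i : ℝ)) atTop (𝓝 (1 / lam i)) := by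
  have h := (hn.ratio_tendsto i).inv₀ (hn.lam_mem i).1.ne'
  simpa using h

/-- The expression equals `N / n_i`; this is where the weights `1 / λ_i` of the limiting variance
originate. -/
lemma SampleSizeCondition.tendsto_mul_sq (hn : SampleSizeCondition n lam) (i : Fin a) :
    Tendsto (fun m => (n m i : ℝ) * (√(total (n m)) * (1 / (n m i : ℝ))) ^ 2) atTop
      (𝓝 (1 / lam i)) := by
  refine (hn.tendsto_total_div i).congr' ?_
  filter_upwards [(hn.tendsto_atTop i).eventually_ne_atTop 0] with m hm
  have : (n m i : ℝ) ≠ 0 := by exact_mod_cast hm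
  rw [mul_pow, Real.sq_sqrt (Nat.cast_nonneg _)]
  field_simp

variable {X : Fin a → ℕ → Ω → Fin d → ℝ} {Q : Fin a → Measure (Fin d → ℝ)}

lemma FactorialModel.isProbabilityMeasure [IsProbabilityMeasure P] (hX : FactorialModel P X Q) (i : Fin a) :
    IsProbabilityMeasure (Q i) :=
  (hX.law i 0).isProbabilityMeasure_iff.1 inferInstance

lemma FactorialModel.aemeasurable_eval (hX : FactorialModel P X Q) (i : Fin a) (k : ℕ)
    (j : Fin d) : AEMeasurable (fun ω => X i k ω j) P :=
  (measurable_pi_apply j).comp_aemeasurable (hX.law i k).aemeasurable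

lemma FactorialModel.aemeasurable_pHat (hX : FactorialModel P X Q) (n : Fin a → ℕ)
    (h : Fin a × Fin d) : AEMeasurable (fun ω => pHat X n ω h) P := by
  unfold pHat wHat
  refine (Finset.aemeasurable_fun_sum _ fun l _ => (Finset.aemeasurable_fun_sum _ fun k _ =>
    Finset.aemeasurable_fun_sum _ fun r _ => ?_).const_mul _).const_mul _
  exact measurable_c.comp_aemeasurable
    ((hX.aemeasurable_eval h.1 k h.2).sub (hX.aemeasurable_eval l r h.2))

variable [IsProbabilityMeasure P] [∀ i, IsProbabilityMeasure (Q i)]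

lemma FactorialModel.integrable_pairRemainder (hX : FactorialModel P X Q) (n : Fin a → ℕ)
    (l i : Fin a) (j : Fin d) : Integrable (pairRemainder X Q n l i j) P := by
  unfold pairRemainder
  refine (integrable_finsetSum _ fun k _ => integrable_finsetSum _ fun r _ => ?_).const_mul _
  exact Integrable.of_bound ((measurable_degenerateKernel _ _).comp_aemeasurable
    ((hX.aemeasurable_eval i k j).prodMk (hX.aemeasurable_eval l r j))).aestronglyMeasurable 2
    (Eventually.of_forall fun ω => abs_degenerateKernel_le _ _ _ _)

lemma FactorialModel.integral_abs_pairRemainder_le (hX : FactorialModel P X Q) (n : Fin a → ℕ)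
    (l i : Fin a) (j : Fin d) :
    ∫ ω, |pairRemainder X Q n l i j ω| ∂P ≤
      (1 / (n l : ℝ)) * (1 / (n i : ℝ)) * (2 * √(n i * n l)) := by
  rcases eq_or_ne i l with rfl | hil
  -- The moment bound needs two different groups; on the diagonal the remainder is identically zero.
  · simp only [pairRemainder_self, abs_zero, integral_zero]
    positivity
  have hm : Measurable (Function.uncurry fun x y : Fin d → ℝ =>
      degenerateKernel (marginal Q l j) (marginal Q i j) (x j) (y j)) := by
    have hxy : Measurable fun z : (Fin d → ℝ) × (Fin d → ℝ) => (z.1 j, z.2 j) := by fun_prop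
    exact (measurable_degenerateKernel (marginal Q l j) (marginal Q i j)).comp hxy
  have hb := integral_abs_sum_sum_le hX.indep hX.law hil
    (h := fun x y => degenerateKernel (marginal Q l j) (marginal Q i j) (x j) (y j)) hm
    (fun x y => abs_degenerateKernel_le _ _ _ _)
    (fun y => by
      rw [← integral_marginal Q (f := fun z => degenerateKernel _ _ z (y j))
        ((measurable_degenerateKernel _ _).comp (measurable_id.prodMk measurable_const))]
      exact integral_degenerateKernel_left _ _ _)
    (fun x => by
      rw [← integral_marginal Q (f := fun z => degenerateKernel _ _ (x j) z)
        ((measurable_degenerateKernel _ _).comp (measurable_const.prodMk measurable_id))]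
      exact integral_degenerateKernel_right _ _ _) (n i) (n l)
  unfold pairRemainder
  simp_rw [abs_mul]
  rw [integral_const_mul, abs_of_nonneg (by positivity), abs_of_nonneg (by positivity)]
  rw [abs_two] at hb
  exact mul_le_mul_of_nonneg_left hb (by positivity)

lemma FactorialModel.tendsto_integral_abs_pairRemainder (hX : FactorialModel P X Q)
    (hn : SampleSizeCondition n lam) (l i : Fin a) (j : Fin d) :
    Tendsto (fun m => √(total (n m)) * ∫ ω, |pairRemainder X Q (n m) l i j ω| ∂P) atTop (𝓝 0) := by
  -- This is `2 √N / √(n_l n_i)`: the ratio `N / n_l` stays bounded and `1 / n_i → 0`.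
  have hlim : Tendsto (fun m => 2 * √((total (n m) : ℝ) / (n m l : ℝ) * ((n m i : ℝ))⁻¹)) atTop
      (𝓝 0) := by
    have h1 : Tendsto (fun m => ((n m i : ℝ))⁻¹) atTop (𝓝 0) :=
      tendsto_inv_atTop_zero.comp (tendsto_natCast_atTop_atTop.comp (hn.tendsto_atTop i))
    have h2 := (Real.continuous_sqrt.tendsto _).comp ((hn.tendsto_total_div l).mul h1)
    simpa using h2.const_mul 2
  refine tendsto_of_tendsto_of_tendsto_of_le_of_le' tendsto_const_nhds hlim
    (Eventually.of_forall fun m => mul_nonneg (Real.sqrt_nonneg _)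
      (integral_nonneg fun ω => abs_nonneg _)) ?_
  filter_upwards [(hn.tendsto_atTop i).eventually_ne_atTop 0,
    (hn.tendsto_atTop l).eventually_ne_atTop 0] with m hi hl
  refine (mul_le_mul_of_nonneg_left (hX.integral_abs_pairRemainder_le (n m) l i j)
    (Real.sqrt_nonneg _)).trans_eq ?_
  have hi' : (0 : ℝ) < n m i := by exact_mod_cast Nat.pos_of_ne_zero hi
  have hl' : (0 : ℝ) < n m l := by exact_mod_cast Nat.pos_of_ne_zero hl
  rw [Real.sqrt_mul hi'.le, Real.sqrt_mul (by positivity), Real.sqrt_div (by positivity),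
    Real.sqrt_inv]
  have h1 := Real.mul_self_sqrt hi'.le
  have h2 := Real.mul_self_sqrt hl'.le
  have h3 := Real.sqrt_pos.2 hi'
  have h4 := Real.sqrt_pos.2 hl'
  have e1 : 1 / (n m i : ℝ) = 1 / (√(n m i) * √(n m i)) := by rw [h1]
  have e2 : 1 / (n m l : ℝ) = 1 / (√(n m l) * √(n m l)) := by rw [h2]
  rw [e1, e2]
  field_simp

/-- Asymptotic normality of the estimated effects. -/
theorem tendstoInDistribution_pHat {Ω' : Type*} [MeasurableSpace Ω'] {P' : Measure Ω'}
    [IsProbabilityMeasure P'] (hX : FactorialModel P X Q) (hn : SampleSizeCondition n lam)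
    {Z : Ω' → EuclideanSpace ℝ (Fin a × Fin d)}
    (hZ : HasLaw Z (multivariateGaussian 0 (Sigma Q lam)) P') :
    TendstoInDistribution
      (fun m ω => WithLp.toLp 2 (√(total (n m)) • (pHat X (n m) ω - effect Q))) atTop Z
      (fun _ => P) P' := by
  have hVm (m : ℕ) : AEMeasurable
      (fun ω => WithLp.toLp 2 (√(total (n m)) • (pHat X (n m) ω - effect Q))) P := by
    refine (WithLp.measurable_toLp 2 _).comp_aemeasurable (aemeasurable_pi_lambda _ fun h => ?_)
    exact ((hX.aemeasurable_pHat (n m) h).sub_const _).const_mul _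
  refine ⟨hVm, hZ.aemeasurable, ProbabilityMeasure.tendsto_iff_tendsto_charFun.2 fun t => ?_⟩
  simp only [ProbabilityMeasure.coe_mk]
  rw [hZ.map_eq, charFun_multivariateGaussian (posSemidef_Sigma Q fun i => (hn.lam_mem i).1.le)]
  simp_rw [fun m => charFun_map_eq_charFun_map_inner (hVm m) t]
  -- In direction `t`, the scaled error splits into a linear part `L`, built from `f`, and a
  -- degenerate part `R`.
  let f : Fin a → (Fin d → ℝ) → ℝ := fun g x => ∑ h, t h * influence Q g x h
  let L : ℕ → Ω → ℝ := fun m ω => ∑ g, (√(total (n m)) * (1 / (n m g : ℝ))) *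
    ∑ k ∈ Finset.range (n m g), f g (X g k ω)
  let R : ℕ → Ω → ℝ := fun m ω => ∑ h : Fin a × Fin d, t h * ((1 / (a : ℝ)) *
    ∑ l, √(total (n m)) * pairRemainder X Q (n m) l h.1 h.2 ω)
  have hf (g : Fin a) : Measurable (f g) :=
    Finset.measurable_fun_sum _ fun h _ => (measurable_influence Q g h).const_mul _
  have hfL (g : Fin a) : MemLp (f g) 2 (Q g) :=
    memLp_finsetSum _ fun h _ => (memLp_influence Q g h).const_mul _
  have hf0 (g : Fin a) : ∫ x, f g x ∂(Q g) = 0 := by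
    simp only [f]
    rw [integral_finsetSum _ fun h _ =>
      ((memLp_influence Q g h).integrable (by norm_num)).const_mul _]
    simp [integral_const_mul, integral_influence]
  have hL := tendsto_charFun_map_sum_groups hX.indep hX.law hf hfL hf0 hn.tendsto_atTop
    hn.tendsto_mul_sq
  have hLm (m : ℕ) : AEMeasurable (L m) P :=
    Finset.aemeasurable_fun_sum _ fun g _ => (Finset.aemeasurable_fun_sum _ fun k _ =>
      (hf g).comp_aemeasurable (hX.law g k).aemeasurable).const_mul _
  have hpR (m : ℕ) (l i : Fin a) (j : Fin d) := hX.integrable_pairRemainder (n m) l i j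
  have hRint (m : ℕ) : Integrable (R m) P :=
    integrable_finsetSum _ fun h _ => ((integrable_finsetSum _ fun l _ =>
      (hpR m l h.1 h.2).const_mul _).const_mul _).const_mul _
  -- Only eventually, because the decomposition requires every group to be nonempty.
  have hdec : ∀ᶠ m in atTop, ∀ ω,
      inner ℝ (WithLp.toLp 2 (√(total (n m)) • (pHat X (n m) ω - effect Q))) t =
        L m ω + R m ω := by
    filter_upwards [eventually_all.2 fun i => (hn.tendsto_atTop i).eventually_ne_atTop 0] with m hm ω
    simp only [PiLp.inner_apply, Pi.smul_apply, Pi.sub_apply, smul_eq_mul,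
      pHat_sub_effect X Q (n m) hm, L, R, f]
    simp only [RCLike.inner_apply, conj_trivial, mul_add, Finset.sum_add_distrib, Finset.mul_sum]
    congr 1
    · rw [Finset.sum_comm]
      refine Finset.sum_congr rfl fun g _ => ?_
      rw [Finset.sum_comm]
      exact Finset.sum_congr rfl fun k _ => Finset.sum_congr rfl fun h _ => by ring
    · exact Finset.sum_congr rfl fun h _ => Finset.sum_congr rfl fun l _ => by ring
  have hRlim : Tendsto (fun m => ∫ ω, |R m ω| ∂P) atTop (𝓝 0) := by
    have hb : Tendsto (fun m => ∑ h : Fin a × Fin d, |t h| * ((1 / (a : ℝ)) *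
        ∑ l, √(total (n m)) * ∫ ω, |pairRemainder X Q (n m) l h.1 h.2 ω| ∂P)) atTop (𝓝 0) := by
      have := tendsto_finsetSum (Finset.univ : Finset (Fin a × Fin d)) fun h _ =>
        ((tendsto_finsetSum (Finset.univ : Finset (Fin a)) fun l _ =>
          hX.tendsto_integral_abs_pairRemainder hn l h.1 h.2).const_mul (1 / (a : ℝ))).const_mul |t h|
      simpa using this
    refine squeeze_zero (fun m => integral_nonneg fun ω => abs_nonneg _) (fun m => ?_) hb
    have hi1 (h : Fin a × Fin d) (l : Fin a) :
        Integrable (fun ω => √(total (n m)) * |pairRemainder X Q (n m) l h.1 h.2 ω|) P :=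
      (hpR m l h.1 h.2).abs.const_mul _
    have hi2 (h : Fin a × Fin d) : Integrable (fun ω => |t h| * ((1 / (a : ℝ)) *
        ∑ l, √(total (n m)) * |pairRemainder X Q (n m) l h.1 h.2 ω|)) P :=
      ((integrable_finsetSum _ fun l _ => hi1 h l).const_mul _).const_mul _
    calc ∫ ω, |R m ω| ∂P ≤ ∫ ω, ∑ h : Fin a × Fin d, |t h| * ((1 / (a : ℝ)) *
          ∑ l, √(total (n m)) * |pairRemainder X Q (n m) l h.1 h.2 ω|) ∂P := by
          refine integral_mono (hRint m).abs (integrable_finsetSum _ fun h _ => hi2 h) fun ω => ?_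
          refine (Finset.abs_sum_le_sum_abs _ _).trans (Finset.sum_le_sum fun h _ => ?_)
          rw [abs_mul, abs_mul, abs_of_nonneg (show (0 : ℝ) ≤ 1 / a by positivity)]
          gcongr
          refine (Finset.abs_sum_le_sum_abs _ _).trans (Finset.sum_le_sum fun l _ => ?_)
          rw [abs_mul, abs_of_nonneg (Real.sqrt_nonneg _)]
      _ = _ := by
          rw [integral_finsetSum _ fun h _ => hi2 h]
          refine Finset.sum_congr rfl fun h _ => ?_
          rw [integral_const_mul, integral_const_mul, integral_finsetSum _ fun l _ => hi1 h l]
          simp_rw [integral_const_mul]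
  have hdiff : Tendsto (fun m => charFun (P.map fun ω => inner ℝ
      (WithLp.toLp 2 (√(total (n m)) • (pHat X (n m) ω - effect Q))) t) 1 -
      charFun (P.map (L m)) 1) atTop (𝓝 0) := by
    refine squeeze_zero_norm' ?_ hRlim
    filter_upwards [hdec] with m hm
    simp_rw [hm]
    have := norm_charFun_map_sub_le (P := P) (A := fun ω => L m ω + R m ω) (B := L m)
      ((hLm m).add (hRint m).aemeasurable) (hLm m) (by simpa using hRint m)
    simpa using this
  have hfin := hdiff.add hL
  simp only [L, sub_add_cancel] at hfin
  convert hfin using 2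
  rw [dotProduct_Sigma_mulVec]
  simp [f]

/-- Because `T p = 0` and `T` is symmetric, both cross terms and the constant term vanish, so
centering at `p` costs nothing. -/
lemma ATS_eq_quadraticForm {Ω : Type*} {a d : ℕ} {X : Fin a → ℕ → Ω → Fin d → ℝ}
    {T : Matrix (Fin a × Fin d) (Fin a × Fin d) ℝ} (hTsymm : T.IsSymm)
    {p : Fin a × Fin d → ℝ} (hp : T *ᵥ p = 0) (n : Fin a → ℕ) (ω : Ω) :
    ATS T X n ω = (√(total n) • (pHat X n ω - p)) ⬝ᵥ (T *ᵥ (√(total n) • (pHat X n ω - p))) := by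
  have hp' (q : Fin a × Fin d → ℝ) : p ⬝ᵥ (T *ᵥ q) = 0 := by
    rw [dotProduct_mulVec, ← mulVec_transpose, hTsymm.eq, hp, zero_dotProduct]
  rw [mulVec_smul, mulVec_sub, hp, sub_zero, smul_dotProduct, dotProduct_smul, sub_dotProduct, hp',
    sub_zero, smul_smul, Real.mul_self_sqrt (Nat.cast_nonneg _), smul_eq_mul, ATS]

end Limit

end RankMANOVA

theorem corollary1
    {Ω Ω' Ω'' : Type*} [MeasurableSpace Ω] [MeasurableSpace Ω'] [MeasurableSpace Ω'']
    (P : Measure Ω) [IsProbabilityMeasure P]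
    (P' : Measure Ω') [IsProbabilityMeasure P']
    (P'' : Measure Ω'') [IsProbabilityMeasure P'']
    {a d : ℕ}
    -- the data, with group laws `Q i`
    (X : Fin a → ℕ → Ω → Fin d → ℝ) (Q : Fin a → Measure (Fin d → ℝ))
    (hX : RankMANOVA.FactorialModel P X Q)
    -- the sample sizes
    (n : ℕ → Fin a → ℕ) (lam : Fin a → ℝ) (hn : RankMANOVA.SampleSizeCondition n lam)
    -- the projection matrix and the null hypothesis
    (T : Matrix (Fin a × Fin d) (Fin a × Fin d) ℝ) (hTsymm : T.IsSymm)
    (hTidem : IsIdempotentElem T) (hH0 : T *ᵥ RankMANOVA.effect Q = 0)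
    -- `Z ∼ N(0, Σ)`
    (Z : Ω' → EuclideanSpace ℝ (Fin a × Fin d))
    (hZ : HasLaw Z (multivariateGaussian 0 (RankMANOVA.Sigma Q lam)) P')
    -- independent standard normal variables `Y_h`
    (Y : Fin a × Fin d → Ω'' → ℝ) (hYindep : iIndepFun Y P'')
    (hYlaw : ∀ h, HasLaw (Y h) (gaussianReal 0 1) P'') :
    (RankMANOVA.Sigma Q lam).PosSemidef ∧
    TendstoInDistribution (fun m => RankMANOVA.ATS T X (n m)) atTop
      (fun ω => (Z ω).ofLp ⬝ᵥ (T *ᵥ (Z ω).ofLp)) (fun _ => P) P' ∧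
    ∃ hA : (CFC.sqrt (RankMANOVA.Sigma Q lam) * T *
        CFC.sqrt (RankMANOVA.Sigma Q lam)).IsHermitian,
      (∀ h, 0 ≤ hA.eigenvalues h) ∧
      IdentDistrib (fun ω => (Z ω).ofLp ⬝ᵥ (T *ᵥ (Z ω).ofLp))
        (fun ω => ∑ h, hA.eigenvalues h * (Y h ω) ^ 2) P' P'' := by
  have hQ := hX.isProbabilityMeasure
  have hA := RankMANOVA.posSemidef_sqrt_mul_mul_sqrt (RankMANOVA.Sigma Q lam) hTsymm hTidem
  refine ⟨RankMANOVA.posSemidef_Sigma Q fun i => (hn.lam_mem i).1.le, ?_, hA.1,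
    hA.eigenvalues_nonneg, RankMANOVA.identDistrib_quadraticForm hA.1 hZ hYindep hYlaw⟩
  -- Continuous mapping with the quadratic form of `T`; by the null hypothesis its values at the
  -- centered scaled estimator are the statistic itself.
  have hlim := (RankMANOVA.tendstoInDistribution_pHat hX hn hZ).continuous_comp
    (g := fun v : EuclideanSpace ℝ (Fin a × Fin d) => v.ofLp ⬝ᵥ (T *ᵥ v.ofLp)) (by fun_prop)
  refine hlim.congr (fun m => Eventually.of_forall fun ω => ?_) (ae_eq_refl _)
  exact (RankMANOVA.ATS_eq_quadraticForm hTsymm hH0 (n m) ω).symm
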